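/- Let $\sigma$ be a finite relational signature all of whose relation symbols have positive arity. All $\sigma$-structures are finite and non-empty. First-order formulas over $\sigma$ are built from atoms $x=y$ and $R(x_1,\dots,x_m)$ by $\neg$, $\vee$ and $\exists$; the size $\|\varphi\|$ of a formula $\varphi$ is its length as a word (parentheses and commas included). For $\ell\ge 1$ let $\mathcal B\Sigma_{0,\ell}$ be the set of quantifier-free formulas, and let $\mathcal B\Sigma_{n+1,\ell}$ be the set of Boolean combinations of formulas $\exists x_1\cdots\exists x_j\,\psi$ with $0\le j\le\ell$ and $\psi\in\mathcal B\Sigma_{n,\ell}$. For a tuple $\bar a$ in a structure $A$, the $r$-sphere $\mathcal N_r^{A}(\bar a)$ is the substructure of $A$ induced on the elements at distance at most $r$ from $\bar a$ in the Gaifman graph of $A$, with the entries of $\bar a$ as distinguished elements. For $\bar a\in A^k$ and $\bar b\in B^k$ write $(A,\bar a)\leftrightharpoons_r(B,\bar b)$ if there is a bijection $f\colon A\to B$ with $\mathcal N_r^{A}(\bar a,c)\cong\mathcal N_r^{B}(\bar b,f(c))$ for all $c\in A$. A formula $\varphi(\bar x)$ with $|\bar x|=k$ is Hanf-local if there is an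 $r\ge 0$ such that $(A,\bar a)\leftrightharpoons_r(B,\bar b)$ implies $A\models\varphi[\bar a]\Leftrightarrow B\models\varphi[\bar b]$, for all structures $A,B$ and all $\bar a\in A^k$, $\bar b\in B^k$; the least such $r$ is its Hanf-locality rank $\mathrm{lr}(\varphi)$. **Theorem.** Let $n\ge 0$ and $\ell\ge 1$, let $\varphi\in\mathcal B\Sigma_{n,\ell}$, and let $\bar x$ be a tuple of pairwise distinct variables with $|\bar x|>0$ that contains all free variables of $\varphi$. Then $\varphi(\bar x)$ is Hanf-local, and $$\mathrm{lr}(\varphi)<(2\ell+1)^n\qquad\text{and}\qquad \mathrm{lr}(\varphi)<\|\varphi\|^n .$$ If moreover $\ell$ is the least positive integer with $\varphi\in\mathcal B\Sigma_{n,\ell}$, then $(2\ell+1)^n\le\|\varphi\|^n$, so that $\mathrm{lr}(\varphi)<(2\ell+1)^n\le\|\varphi\|^n$. -/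

import Mathlib

open scoped FirstOrder

namespace HanfLocality

universe u v

/-! ### First-order formulas over a relational signature

A signature is a `FirstOrder.Language` without function and constant symbols; structure variables
are natural numbers. -/

/-- First-order formulas with named variables, built from atoms by negation, disjunction and
existential quantification. -/
inductive FO (L : FirstOrder.Language.{u, v}) : Type v
  | eq (x y : ℕ) : FO L
  | rel {n : ℕ} (R : L.Relations n) (xs : Fin n → ℕ) : FO L
  | not (φ : FO L) : FO L
  | or (φ ψ : FO L) : FO L
  | ex (y : ℕ) (φ : FO L) : FO L

namespace FO

variable {L : FirstOrder.Language.{u, v}}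

/-- Satisfaction of a formula in a structure under an assignment. -/
def Realize {A : Type} [L.Structure A] : FO L → (ℕ → A) → Prop
  | eq x y, β => β x = β y
  | rel R xs, β => FirstOrder.Language.Structure.RelMap R (fun i => β (xs i))
  | not φ, β => ¬ φ.Realize β
  | or φ ψ, β => φ.Realize β ∨ ψ.Realize β
  | ex y φ, β => ∃ a : A, φ.Realize (Function.update β y a)

/-- The set of free variables. -/
def free : FO L → Set ℕ
  | eq x y => {x, y}
  | rel _ xs => Set.range xs
  | not φ => φ.free
  | or φ ψ => φ.free ∪ ψ.free
  | ex y φ => φ.free \ {y}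

/-- The size of a formula: its length as a word, where parentheses and commas count as letters.
The words are `x=y`, `R(x₁,…,xₙ)` (with `n ≥ 1`), `¬φ`, `(φ∨ψ)` and `∃yφ`. -/
def size : FO L → ℕ
  | eq _ _ => 3
  | rel (n := n) _ _ => 2 * n + 2
  | not φ => φ.size + 1
  | or φ ψ => φ.size + ψ.size + 3
  | ex _ φ => φ.size + 2

/-- Quantifier-free formulas. -/
def IsQF : FO L → Prop
  | eq _ _ => True
  | rel _ _ => True
  | not φ => φ.IsQF
  | or φ ψ => φ.IsQF ∧ ψ.IsQF
  | ex _ _ => False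

/-- Boolean combinations of formulas that satisfy `S`. -/
inductive BoolComb (S : FO L → Prop) : FO L → Prop
  | base {φ : FO L} : S φ → BoolComb S φ
  | not {φ : FO L} : BoolComb S φ → BoolComb S (not φ)
  | or {φ ψ : FO L} : BoolComb S φ → BoolComb S ψ → BoolComb S (or φ ψ)

/-- The quantifier block `∃x₁ ∃x₂ ⋯ ∃xₖ ψ`. -/
def exs (xs : List ℕ) (ψ : FO L) : FO L := xs.foldr ex ψ

/-- The class `BΣ_{n,ℓ}`: `BΣ_{0,ℓ}` consists of the quantifier-free formulas, and `BΣ_{n+1,ℓ}`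
of the Boolean combinations of formulas `∃x₁ ⋯ ∃xₖ ψ` with `k ≤ ℓ` and `ψ ∈ BΣ_{n,ℓ}`. -/
def BSigma : ℕ → ℕ → FO L → Prop
  | 0, _ => IsQF
  | n + 1, l => BoolComb fun φ =>
      ∃ (xs : List ℕ) (ψ : FO L), xs.length ≤ l ∧ BSigma n l ψ ∧ φ = exs xs ψ

/-- `A ⊨ φ[ā]`: the formula `φ(x̄)` holds when each variable `x i` is interpreted by `a i`. (For
injective `x` with `free φ ⊆ range x` this does not depend on the assignment chosen.) -/
def Models (φ : FO L) {k : ℕ} (x : Fin k → ℕ) {A : Type} [L.Structure A] (a : Fin k → A) : Prop :=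
  ∃ β : ℕ → A, (∀ i, β (x i) = a i) ∧ φ.Realize β

end FO

/-! ### Spheres -/

section Spheres

variable (L : FirstOrder.Language.{u, v}) {A B : Type} [L.Structure A] [L.Structure B]

variable (A) in
/-- The Gaifman graph of a structure: distinct elements are adjacent if they occur together in a
tuple of some relation. -/
def gaifmanGraph : SimpleGraph A where
  Adj a b := a ≠ b ∧ ∃ (n : ℕ) (R : L.Relations n) (t : Fin n → A),
    FirstOrder.Language.Structure.RelMap R t ∧ a ∈ Set.range t ∧ b ∈ Set.range t
  symm := ⟨fun _ _ h => ⟨h.1.symm, by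
    obtain ⟨n, R, t, hR, ha, hb⟩ := h.2
    exact ⟨n, R, t, hR, hb, ha⟩⟩⟩
  loopless := ⟨fun _ h => h.1 rfl⟩

/-- The `r`-neighbourhood of a tuple: all elements at Gaifman distance at most `r` from some
entry of the tuple. -/
def nbhd (r : ℕ) {k : ℕ} (a : Fin k → A) : Set A :=
  {b | ∃ i, (gaifmanGraph L A).edist (a i) b ≤ r}

theorem mem_nbhd_self (r : ℕ) {k : ℕ} (a : Fin k → A) (i : Fin k) : a i ∈ nbhd L r a :=
  ⟨i, by simp⟩

variable [L.IsRelational]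

/-- The `r`-sphere of a tuple, as the structure induced on its `r`-neighbourhood. -/
def sphere (r : ℕ) {k : ℕ} (a : Fin k → A) : L.Substructure A where
  carrier := nbhd L r a
  fun_mem := fun f => isEmptyElim f

/-- The `i`-th centre of the sphere of `a`. -/
def centre (r : ℕ) {k : ℕ} (a : Fin k → A) (i : Fin k) : sphere L r a :=
  ⟨a i, mem_nbhd_self L r a i⟩

/-- The `r`-spheres of `a` and `b` are isomorphic by an isomorphism that maps centres to
centres, in order. -/
def SphereIso (r : ℕ) {k : ℕ} (a : Fin k → A) (b : Fin k → B) : Prop :=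
  ∃ e : sphere L r a ≃[L] sphere L r b, ∀ i, e (centre L r a i) = centre L r b i

/-- `r`-equivalence `(A, a) ⇆_r (B, b)`: some bijection `f : A → B` is such that the `r`-spheres of
`(a, c)` and `(b, f c)` are isomorphic for all `c`. -/
def HanfEquiv (r : ℕ) {k : ℕ} (a : Fin k → A) (b : Fin k → B) : Prop :=
  ∃ f : A ≃ B, ∀ c : A,
    SphereIso L r (Fin.snoc a c : Fin (k + 1) → A) (Fin.snoc b (f c) : Fin (k + 1) → B)

end Spheres

/-! ### Hanf-locality -/

section Locality

variable {L : FirstOrder.Language.{u, v}} [L.IsRelational]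

/-- `φ(x̄)` does not distinguish `r`-equivalent tuples of finite non-empty structures. (As the
structures are finite, it is enough to let their universes range over `Type`.) -/
def HanfLocalAt (φ : FO L) {k : ℕ} (x : Fin k → ℕ) (r : ℕ) : Prop :=
  ∀ (A B : Type) [Finite A] [Nonempty A] [Finite B] [Nonempty B] [L.Structure A] [L.Structure B]
    (a : Fin k → A) (b : Fin k → B),
    HanfEquiv L r a b → (φ.Models x a ↔ φ.Models x b)

/-- `φ(x̄)` is Hanf-local. -/
def IsHanfLocal (φ : FO L) {k : ℕ} (x : Fin k → ℕ) : Prop :=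
  ∃ r, HanfLocalAt φ x r

/-- The Hanf-locality rank of a Hanf-local formula: the least radius as in `HanfLocalAt`. -/
noncomputable def hanfLocalityRank (φ : FO L) {k : ℕ} (x : Fin k → ℕ) : ℕ :=
  sInf {r | HanfLocalAt φ x r}

end Locality

end HanfLocality

/-! A block of at most `l` quantifiers is treated at once. Let `r` be a radius that suffices below
the block, let the block bind `m` variables, and let `a`, `b` have isomorphic spheres of radius
`m(2r+1)+r`. Every extension of `a` by values for the block needs a counterpart over `b` with an
isomorphic `r`-sphere. `matched_ext` proves more: each type of `r`-sphere is realised equally often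
over `a` and over `b`.

Counting is what makes an induction on `m` work. If a new entry is linked to the old ones, it lies
within `2r+1` of them; the given isomorphism moves it, and one variable is used up. If no new entry
is linked, the `r`-sphere is the disjoint union of its old and its new part (`SIso.union`), so only
the type of the new part matters. Over all extensions, these types occur equally often, by induction
from a single point; the linked extensions are then subtracted.

So radii grow as `r' = l(2r+1)+r`, that is, `2r'+1 = (2l+1)(2r+1)`, which gives the bound
`(2l+1)^n`. For the bound by size, `l` is replaced by the number of quantifiers, or by 1 if there
are none. -/

namespace HanfLocality

open Set FirstOrder.Language

universe u v

/-! ### Gaifman distance, isomorphisms of spheres, and gluing of unlinked spheres -/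

section Distance

variable (L : FirstOrder.Language.{u, v}) {A B C : Type} [L.Structure A] [L.Structure B]
  [L.Structure C] {ι κ : Type}

/-- `x` and `y` have Gaifman distance at most `r`. -/
def Near (r : ℕ) (x y : A) : Prop := (gaifmanGraph L A).edist x y ≤ r

variable {L}

theorem near_zero {x y : A} : Near L 0 x y ↔ x = y := by
  simp [Near]

theorem Near.refl (r : ℕ) (x : A) : Near L r x x := by simp [Near]

theorem Near.symm {r : ℕ} {x y : A} (h : Near L r x y) : Near L r y x := by
  rwa [Near, SimpleGraph.edist_comm]

theorem Near.trans {r s : ℕ} {x y z : A} (h : Near L r x y) (h' : Near L s y z) :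
    Near L (r + s) x z := by
  unfold Near at *
  push_cast
  exact SimpleGraph.edist_triangle.trans (add_le_add h h')

theorem Near.mono {r s : ℕ} (hrs : r ≤ s) {x y : A} (h : Near L r x y) : Near L s x y :=
  le_trans h (by exact_mod_cast hrs)

theorem near_of_relMap {n : ℕ} {R : L.Relations n} {t : Fin n → A} (h : Structure.RelMap R t)
    (i j : Fin n) : Near L 1 (t i) (t j) := by
  by_cases hij : t i = t j
  · rw [hij]; exact Near.refl 1 _
  · have : (gaifmanGraph L A).Adj (t i) (t j) := ⟨hij, n, R, t, h, ⟨i, rfl⟩, ⟨j, rfl⟩⟩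
    have := SimpleGraph.edist_eq_one_iff_adj.2 this
    simp [Near, this]

theorem Near.exists_last {r : ℕ} {x y : A} (h : Near L (r + 1) x y) :
    ∃ z, Near L r x z ∧ (z = y ∨ (gaifmanGraph L A).Adj z y) := by
  have hne : (gaifmanGraph L A).edist x y ≠ ⊤ := ne_top_of_le_ne_top (by simp) h
  obtain ⟨w, hw⟩ := SimpleGraph.exists_walk_of_edist_ne_top hne
  have hlen : w.length ≤ r + 1 := by
    have : (w.length : ℕ∞) ≤ (r + 1 : ℕ) := hw ▸ h
    exact_mod_cast this
  by_cases h0 : w.length = 0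
  · exact ⟨x, Near.refl _ _, Or.inl (SimpleGraph.Walk.eq_of_length_eq_zero h0)⟩
  · have hnn : ¬ w.Nil := fun hn => h0 (SimpleGraph.Walk.length_eq_zero_iff.2 hn)
    refine ⟨w.penultimate, ?_, Or.inr (w.adj_penultimate hnn)⟩
    refine (SimpleGraph.edist_le w.dropLast).trans ?_
    have : w.dropLast.length ≤ r := by simp; omega
    exact_mod_cast this

/-- The elements at distance at most `r` from some `a i` with `i ∈ S`. -/
def Nb (L : FirstOrder.Language.{u, v}) [L.Structure A] (S : Set ι) (r : ℕ) (a : ι → A) : Set A :=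
  {x | ∃ i ∈ S, Near L r (a i) x}

theorem Nb.mem_self {S : Set ι} (r : ℕ) (a : ι → A) {i : ι} (hi : i ∈ S) : a i ∈ Nb L S r a :=
  ⟨i, hi, Near.refl _ _⟩

theorem Nb.near {S : Set ι} {r s : ℕ} {a : ι → A} {x y : A} (hx : x ∈ Nb L S r a)
    (h : Near L s x y) : y ∈ Nb L S (r + s) a := by
  obtain ⟨i, hi, hx⟩ := hx
  exact ⟨i, hi, hx.trans h⟩

theorem Nb.mono {S T : Set ι} (hST : S ⊆ T) {r s : ℕ} (hrs : r ≤ s) (a : ι → A) :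
    Nb L S r a ⊆ Nb L T s a := by
  rintro x ⟨i, hi, hx⟩
  exact ⟨i, hST hi, hx.mono hrs⟩

theorem Nb.congr {S : Set ι} {r : ℕ} {a a' : ι → A} (h : EqOn a a' S) :
    Nb L S r a = Nb L S r a' := by
  ext x
  constructor
  · rintro ⟨i, hi, hx⟩; exact ⟨i, hi, h hi ▸ hx⟩
  · rintro ⟨i, hi, hx⟩; exact ⟨i, hi, h hi ▸ hx⟩

theorem Nb.union (S T : Set ι) (r : ℕ) (a : ι → A) :
    Nb L (S ∪ T) r a = Nb L S r a ∪ Nb L T r a := by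
  ext x
  simp only [Nb, mem_union, mem_ofPred_eq, or_and_right, exists_or]

theorem nb_univ_eq_nbhd (r : ℕ) {k : ℕ} (a : Fin k → A) : Nb L univ r a = nbhd L r a := by
  ext x
  simp [Nb, nbhd, Near]

/-- `f` restricts to an isomorphism of the `r`-spheres of `a` and `b`, considered as tuples with
index set `S`. -/
structure IsIso (L : FirstOrder.Language.{u, v}) [L.Structure A] [L.Structure B]
    (f : A → B) (S : Set ι) (r : ℕ) (a : ι → A) (b : ι → B) : Prop where
  bijOn : BijOn f (Nb L S r a) (Nb L S r b)
  map_centre : ∀ i ∈ S, f (a i) = b i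
  map_rel : ∀ {n : ℕ} (R : L.Relations n) (t : Fin n → A), (∀ i, t i ∈ Nb L S r a) →
    (Structure.RelMap R (f ∘ t) ↔ Structure.RelMap R t)

namespace IsIso

variable {S : Set ι} {r : ℕ} {a : ι → A} {b : ι → B} {c : ι → C} {f : A → B} {g : B → C}

theorem refl (S : Set ι) (r : ℕ) (a : ι → A) : IsIso L id S r a a :=
  ⟨bijOn_id _, fun _ _ => rfl, fun _ _ _ => Iff.rfl⟩

theorem trans (hf : IsIso L f S r a b) (hg : IsIso L g S r b c) : IsIso L (g ∘ f) S r a c where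
  bijOn := hg.bijOn.comp hf.bijOn
  map_centre i hi := by simp [hf.map_centre i hi, hg.map_centre i hi]
  map_rel R t ht := by
    rw [← hf.map_rel R t ht, ← hg.map_rel R (f ∘ t) fun i => hf.bijOn.mapsTo (ht i)]
    rfl

theorem invOn [Nonempty A] (hf : IsIso L f S r a b) :
    InvOn (Function.invFunOn f (Nb L S r a)) f (Nb L S r a) (Nb L S r b) :=
  hf.bijOn.invOn_invFunOn

theorem symm [Nonempty A] (hf : IsIso L f S r a b) :
    IsIso L (Function.invFunOn f (Nb L S r a)) S r b a where
  bijOn := hf.bijOn.symm hf.invOn.symm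
  map_centre i hi := by
    rw [← hf.map_centre i hi]
    exact hf.invOn.1 (Nb.mem_self r a hi)
  map_rel R t ht := by
    rw [← hf.map_rel R (Function.invFunOn f (Nb L S r a) ∘ t) fun i =>
      (hf.bijOn.symm hf.invOn.symm).mapsTo (ht i)]
    have : f ∘ Function.invFunOn f (Nb L S r a) ∘ t = t := by
      funext i; exact hf.invOn.2 (ht i)
    rw [this]

/-- Follow a path from `x`: the tuple that witnesses a step has all its entries within `q` of `x`,
hence inside the `r`-ball, where `f` preserves relations. -/
theorem map_near (hf : IsIso L f S r a b) {s q : ℕ} (hsq : s + q ≤ r) {x y : A}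
    (hx : x ∈ Nb L S s a) (hxy : Near L q x y) : Near L q (f x) (f y) := by
  induction q generalizing y with
  | zero => rw [near_zero] at hxy ⊢; rw [hxy]
  | succ q ih =>
    obtain ⟨z, hxz, hzy⟩ := hxy.exists_last
    have h1 := ih (by omega) hxz
    rcases hzy with rfl | ⟨-, n, R, t, hR, ⟨i, rfl⟩, ⟨j, rfl⟩⟩
    · exact h1.mono (by omega)
    · have ht : ∀ k, t k ∈ Nb L S r a := fun k =>
        Nb.mono Subset.rfl hsq a (Nb.near hx (hxz.trans (near_of_relMap hR i k)))
      exact h1.trans (near_of_relMap ((hf.map_rel R t ht).2 hR) i j)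

theorem mapsTo_nb (hf : IsIso L f S r a b) {s : ℕ} (hs : s ≤ r) :
    MapsTo f (Nb L S s a) (Nb L S s b) := by
  rintro x ⟨i, hi, hx⟩
  refine ⟨i, hi, ?_⟩
  rw [← hf.map_centre i hi]
  exact hf.map_near (s := 0) (by omega) (Nb.mem_self 0 a hi) hx

/-- Every change of centres or radius goes through this lemma. The smaller balls are mapped onto
each other because neither `f` nor its inverse increases the distances concerned. -/
theorem restrict [Nonempty A] (hf : IsIso L f S r a b) {T : Set κ} {s q : ℕ} (hsq : s + q ≤ r)
    {c : κ → A} {d : κ → B} (hc : ∀ i ∈ T, c i ∈ Nb L S s a) (hd : ∀ i ∈ T, f (c i) = d i) :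
    IsIso L f T q c d := by
  have hsub : Nb L T q c ⊆ Nb L S r a := by
    rintro x ⟨i, hi, hx⟩
    exact Nb.mono Subset.rfl hsq a (Nb.near (hc i hi) hx)
  refine ⟨⟨?_, hf.bijOn.injOn.mono hsub, ?_⟩, hd, fun R t ht => hf.map_rel R t fun i => hsub (ht i)⟩
  · rintro x ⟨i, hi, hx⟩
    exact ⟨i, hi, hd i hi ▸ hf.map_near hsq (hc i hi) hx⟩
  · rintro y ⟨i, hi, hy⟩
    have hdi : d i ∈ Nb L S s b := hd i hi ▸ hf.mapsTo_nb (by omega) (hc i hi)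
    have hyb : y ∈ Nb L S r b := Nb.mono Subset.rfl hsq b (Nb.near hdi hy)
    refine ⟨_, ⟨i, hi, ?_⟩, hf.invOn.2 hyb⟩
    have h := hf.symm.map_near hsq hdi hy
    rwa [← hd i hi, hf.invOn.1 (Nb.mono Subset.rfl (by omega) a (hc i hi))] at h

theorem bijOn_nb [Nonempty A] (hf : IsIso L f S r a b) {s : ℕ} (hs : s ≤ r) :
    BijOn f (Nb L S s a) (Nb L S s b) :=
  (hf.restrict (T := S) (s := 0) (q := s) (c := a) (d := b) (by omega)
    (fun _ hi => Nb.mem_self 0 a hi) hf.map_centre).bijOn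

end IsIso

/-- The `r`-spheres of `a` and `b`, considered as tuples with index set `S`, are isomorphic. -/
def SIso (L : FirstOrder.Language.{u, v}) [L.Structure A] [L.Structure B]
    (S : Set ι) (r : ℕ) (a : ι → A) (b : ι → B) : Prop :=
  ∃ f : A → B, IsIso L f S r a b

namespace SIso

variable {S T : Set ι} {r q : ℕ} {a a' : ι → A} {b b' : ι → B}

theorem mono [Nonempty A] (h : SIso L S r a b) (hTS : T ⊆ S) (hqr : q ≤ r) : SIso L T q a b := by
  obtain ⟨f, hf⟩ := h
  exact ⟨f, hf.restrict (s := 0) (by omega) (fun i hi => Nb.mem_self 0 a (hTS hi))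
    fun i hi => hf.map_centre i (hTS hi)⟩

theorem congr [Nonempty A] (h : SIso L S r a b) (ha : EqOn a' a S) (hb : EqOn b' b S) :
    SIso L S r a' b' := by
  obtain ⟨f, hf⟩ := h
  exact ⟨f, hf.restrict (s := 0) (by omega) (fun i hi => by rw [ha hi]; exact Nb.mem_self 0 a hi)
    fun i hi => by rw [ha hi, hb hi, hf.map_centre i hi]⟩

theorem symm [Nonempty A] (h : SIso L S r a b) : SIso L S r b a := by
  obtain ⟨f, hf⟩ := h
  exact ⟨_, hf.symm⟩

end SIso

/-- The `r`-spheres around `c i`, `i ∈ S`, and around `c j` overlap, or a relation that holds inside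
the `r`-sphere of `c`, as a tuple with index set `U`, connects them. -/
def Linked (L : FirstOrder.Language.{u, v}) [L.Structure A] (S U : Set ι) (r : ℕ) (c : ι → A)
    (j : ι) : Prop :=
  ∃ z ∈ Nb L S r c, ∃ w ∈ Nb L {j} r c, z = w ∨
    ∃ (n : ℕ) (R : L.Relations n) (t : Fin n → A), (∀ i, t i ∈ Nb L U r c) ∧
      Structure.RelMap R t ∧ z ∈ range t ∧ w ∈ range t

/-- Two radii `r` and one step between the spheres. -/
theorem Linked.mem_nb {S U : Set ι} {r : ℕ} {c : ι → A} {j : ι} (h : Linked L S U r c j) :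
    c j ∈ Nb L S (2 * r + 1) c := by
  obtain ⟨z, hz, w, ⟨i, rfl, hw⟩, h⟩ := h
  have hzw : Near L 1 z w := by
    rcases h with rfl | ⟨n, R, t, -, hR, ⟨k, rfl⟩, ⟨k', rfl⟩⟩
    · exact Near.refl _ _
    · exact near_of_relMap hR k k'
  exact Nb.mono Subset.rfl (by omega) c (Nb.near (Nb.near hz hzw) hw.symm)

/-- The connecting relation has to hold inside the sphere of `U`; this is what makes being linked an
invariant of the type of that sphere. -/
theorem Linked.map {S U : Set ι} {r : ℕ} {c : ι → A} {d : ι → B} {j : ι}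
    (h : Linked L S U r c j) [Nonempty A] (hSU : S ⊆ U) (hj : j ∈ U) (hcd : SIso L U r c d) :
    Linked L S U r d j := by
  obtain ⟨f, hf⟩ := hcd
  have hS : IsIso L f S r c d := hf.restrict (s := 0) (by omega)
    (fun i hi => Nb.mem_self 0 c (hSU hi)) fun i hi => hf.map_centre i (hSU hi)
  have hJ : IsIso L f {j} r c d := hf.restrict (s := 0) (by omega)
    (fun i hi => by rw [mem_singleton_iff.1 hi]; exact Nb.mem_self 0 c hj)
    fun i hi => by rw [mem_singleton_iff.1 hi]; exact hf.map_centre j hj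
  obtain ⟨z, hz, w, hw, h⟩ := h
  refine ⟨f z, hS.bijOn.mapsTo hz, f w, hJ.bijOn.mapsTo hw, ?_⟩
  rcases h with rfl | ⟨n, R, t, ht, hR, ⟨k, rfl⟩, ⟨k', rfl⟩⟩
  · exact Or.inl rfl
  · exact Or.inr ⟨n, R, f ∘ t, fun i => hf.bijOn.mapsTo (ht i), (hf.map_rel R t ht).2 hR,
      ⟨k, rfl⟩, ⟨k', rfl⟩⟩

theorem disjoint_nb_of_not_linked {S V : Set ι} {r : ℕ} {c : ι → A}
    (h : ∀ j ∈ V, ¬ Linked L S (S ∪ V) r c j) : Disjoint (Nb L S r c) (Nb L V r c) := by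
  rw [Set.disjoint_left]
  rintro x hx ⟨j, hj, hxj⟩
  exact h j hj ⟨x, hx, x, ⟨j, rfl, hxj⟩, Or.inl rfl⟩

theorem forall_mem_nb_of_relMap {S V : Set ι} {r : ℕ} {c : ι → A}
    (h : ∀ j ∈ V, ¬ Linked L S (S ∪ V) r c j) {n : ℕ} {R : L.Relations n} {t : Fin n → A}
    (ht : ∀ i, t i ∈ Nb L (S ∪ V) r c) (hR : Structure.RelMap R t) :
    (∀ i, t i ∈ Nb L S r c) ∨ ∀ i, t i ∈ Nb L V r c := by
  by_contra! hcon
  obtain ⟨⟨i, hi⟩, k, hk⟩ := hcon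
  rw [Nb.union] at ht
  obtain ⟨j, hj, hij⟩ := (ht i).resolve_left hi
  exact h j hj ⟨t k, (ht k).resolve_right hk, t i, ⟨j, rfl, hij⟩,
    Or.inr ⟨n, R, t, fun l => Nb.union (L := L) S V r c ▸ ht l, hR, ⟨k, rfl⟩, ⟨i, rfl⟩⟩⟩

/-- The two isomorphisms glue since no element is shared and no relation crosses. Links are excluded
on both sides because relations must also be reflected. -/
theorem SIso.union {S V : Set ι} {r : ℕ} {c : ι → A} {d : ι → B}
    (hS : SIso L S r c d) (hV : SIso L V r c d)
    (hc : ∀ j ∈ V, ¬ Linked L S (S ∪ V) r c j) (hd : ∀ j ∈ V, ¬ Linked L S (S ∪ V) r d j) :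
    SIso L (S ∪ V) r c d := by
  classical
  obtain ⟨f, hf⟩ := hS
  obtain ⟨g, hg⟩ := hV
  have hdc := disjoint_nb_of_not_linked hc
  have hdd := disjoint_nb_of_not_linked hd
  have hhf : EqOn ((Nb L S r c).piecewise f g) f (Nb L S r c) := piecewise_eqOn _ f g
  have hhg : EqOn ((Nb L S r c).piecewise f g) g (Nb L V r c) := fun x hx =>
    piecewise_eq_of_notMem _ f g (Set.disjoint_right.1 hdc hx)
  set h := (Nb L S r c).piecewise f g
  have bS : BijOn h (Nb L S r c) (Nb L S r d) := hf.bijOn.congr hhf.symm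
  have bV : BijOn h (Nb L V r c) (Nb L V r d) := hg.bijOn.congr hhg.symm
  have bU : BijOn h (Nb L (S ∪ V) r c) (Nb L (S ∪ V) r d) := by
    rw [Nb.union, Nb.union]
    refine bS.union bV ?_
    rw [injOn_union hdc]
    refine ⟨bS.injOn, bV.injOn, fun x hx y hy hxy => ?_⟩
    exact Set.disjoint_left.1 hdd (bS.mapsTo hx) (hxy ▸ bV.mapsTo hy)
  have relS : ∀ {n : ℕ} (R : L.Relations n) (t : Fin n → A), (∀ i, t i ∈ Nb L S r c) →
      (Structure.RelMap R (h ∘ t) ↔ Structure.RelMap R t) := fun R t ht => by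
    rw [← hf.map_rel R t ht, show h ∘ t = f ∘ t from funext fun i => hhf (ht i)]
  have relV : ∀ {n : ℕ} (R : L.Relations n) (t : Fin n → A), (∀ i, t i ∈ Nb L V r c) →
      (Structure.RelMap R (h ∘ t) ↔ Structure.RelMap R t) := fun R t ht => by
    rw [← hg.map_rel R t ht, show h ∘ t = g ∘ t from funext fun i => hhg (ht i)]
  refine ⟨h, bU, ?_, fun R t ht => ⟨fun hR => ?_, fun hR => ?_⟩⟩
  · rintro i (hi | hi)
    · rw [hhf (Nb.mem_self r c hi), hf.map_centre i hi]
    · rw [hhg (Nb.mem_self r c hi), hg.map_centre i hi]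
  · have ht' := ht
    rw [Nb.union] at ht'
    rcases forall_mem_nb_of_relMap hd (fun i => bU.mapsTo (ht i)) hR with h' | h'
    · refine (relS R t fun i => ?_).1 hR
      refine (ht' i).resolve_right fun hi => ?_
      exact Set.disjoint_left.1 hdd (h' i) (bV.mapsTo hi)
    · refine (relV R t fun i => ?_).1 hR
      refine (ht' i).resolve_left fun hi => ?_
      exact Set.disjoint_left.1 hdd (bS.mapsTo hi) (h' i)
  · rcases forall_mem_nb_of_relMap hc ht hR with h' | h'
    · exact (relS R t h').2 hR
    · exact (relV R t h').2 hR

end Distance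

/-! ### Label-preserving bijections of finite sets -/

section Matching

/-- Some bijection from `X` to `Y` preserves the labels given by `p` and `q`. -/
def Matched {α β T : Type*} (X : Set α) (Y : Set β) (p : α → T) (q : β → T) : Prop :=
  ∃ f : α → β, BijOn f X Y ∧ ∀ x ∈ X, q (f x) = p x

variable {α β T T' : Type*} {X : Set α} {Y : Set β} {p : α → T} {q : β → T}

theorem Matched.ncard_eq (h : Matched X Y p q) (θ : T) :
    {x ∈ X | p x = θ}.ncard = {y ∈ Y | q y = θ}.ncard := by
  obtain ⟨f, hf, hpq⟩ := h
  have : f '' {x ∈ X | p x = θ} = {y ∈ Y | q y = θ} := by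
    ext y
    constructor
    · rintro ⟨x, ⟨hx, rfl⟩, rfl⟩
      exact ⟨hf.mapsTo hx, hpq x hx⟩
    · rintro ⟨hy, rfl⟩
      obtain ⟨x, hx, rfl⟩ := hf.surjOn hy
      exact ⟨x, ⟨hx, (hpq x hx).symm⟩, rfl⟩
  rw [← this, InjOn.ncard_image (hf.injOn.mono fun x hx => hx.1)]

theorem matched_of_ncard_eq [Nonempty β] (hX : X.Finite) (hY : Y.Finite)
    (h : ∀ θ, {x ∈ X | p x = θ}.ncard = {y ∈ Y | q y = θ}.ncard) : Matched X Y p q := by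
  have hf : ∀ θ, ∃ f : α → β, BijOn f {x ∈ X | p x = θ} {y ∈ Y | q y = θ} := fun θ => by
    have hXθ : {x ∈ X | p x = θ}.Finite := hX.subset fun x hx => hx.1
    have hYθ : {y ∈ Y | q y = θ}.Finite := hY.subset fun x hx => hx.1
    refine hXθ.exists_bijOn_of_encard_eq ?_
    rw [← hXθ.cast_ncard_eq, ← hYθ.cast_ncard_eq, h θ]
  choose f hf using hf
  have hmem : ∀ x ∈ X, f (p x) x ∈ Y ∧ q (f (p x) x) = p x := fun x hx => (hf (p x)).mapsTo ⟨hx, rfl⟩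
  refine ⟨fun x => f (p x) x, ⟨fun x hx => (hmem x hx).1, fun x hx x' hx' hxx' => ?_, ?_⟩,
    fun x hx => (hmem x hx).2⟩
  · have hp : p x' = p x := by
      rw [← (hmem x hx).2, ← (hmem x' hx').2]
      exact congrArg q hxx'.symm
    refine (hf (p x)).injOn ⟨hx, rfl⟩ ⟨hx', hp⟩ ?_
    have : f (p x) x = f (p x') x' := hxx'
    rw [this, hp]
  · intro y hy
    obtain ⟨x, ⟨hx, hpx⟩, hxy⟩ := (hf (q y)).surjOn ⟨hy, rfl⟩
    exact ⟨x, hx, (congrArg (f · x) hpx).trans hxy⟩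

theorem Matched.map_label (h : Matched X Y p q) {p' : α → T'} {q' : β → T'}
    (hpq : ∀ x ∈ X, ∀ y ∈ Y, q y = p x → q' y = p' x) : Matched X Y p' q' := by
  obtain ⟨f, hf, hl⟩ := h
  exact ⟨f, hf, fun x hx => hpq x hx _ (hf.mapsTo hx) (hl x hx)⟩

theorem ncard_fibre_union {X' : Set α} (p : α → T) (θ : T) (hX : (X ∪ X').Finite)
    (hd : Disjoint X X') :
    {x ∈ X ∪ X' | p x = θ}.ncard = {x ∈ X | p x = θ}.ncard + {x ∈ X' | p x = θ}.ncard := by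
  rw [← ncard_union_eq (hd.mono (fun _ hz => hz.1) fun _ hz => hz.1)
    (hX.subset fun z hz => Or.inl hz.1) (hX.subset fun z hz => Or.inr hz.1)]
  congr 1
  ext z
  simp only [mem_union, mem_ofPred_eq, or_and_right]

theorem Matched.union {X' : Set α} {Y' : Set β} [Nonempty β] (hX : (X ∪ X').Finite)
    (hY : (Y ∪ Y').Finite) (hXX : Disjoint X X') (hYY : Disjoint Y Y') (h : Matched X Y p q)
    (h' : Matched X' Y' p q) : Matched (X ∪ X') (Y ∪ Y') p q := by
  refine matched_of_ncard_eq hX hY fun θ => ?_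
  rw [ncard_fibre_union p θ hX hXX, ncard_fibre_union q θ hY hYY, h.ncard_eq, h'.ncard_eq]

/-- The two bijections need not be compatible, so the argument subtracts cardinalities, label by
label. -/
theorem Matched.diff {X' : Set α} {Y' : Set β} [Nonempty β] (hX : X.Finite) (hY : Y.Finite)
    (hXX : X' ⊆ X) (hYY : Y' ⊆ Y) (h : Matched X Y p q) (h' : Matched X' Y' p q) :
    Matched (X \ X') (Y \ Y') p q := by
  refine matched_of_ncard_eq (hX.subset sdiff_subset) (hY.subset sdiff_subset) fun θ => ?_
  have e1 : {x ∈ X \ X' | p x = θ} = {x ∈ X | p x = θ} \ {x ∈ X' | p x = θ} := by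
    ext x; simp only [mem_sdiff, mem_ofPred_eq]; tauto
  have e2 : {x ∈ Y \ Y' | q x = θ} = {x ∈ Y | q x = θ} \ {x ∈ Y' | q x = θ} := by
    ext x; simp only [mem_sdiff, mem_ofPred_eq]; tauto
  have s1 : {x ∈ X' | p x = θ} ⊆ {x ∈ X | p x = θ} := fun x hx => ⟨hXX hx.1, hx.2⟩
  have s2 : {x ∈ Y' | q x = θ} ⊆ {x ∈ Y | q x = θ} := fun x hx => ⟨hYY hx.1, hx.2⟩
  rw [e1, e2, ncard_sdiff s1 ((hX.subset hXX).subset fun x hx => hx.1),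
    ncard_sdiff s2 ((hY.subset hYY).subset fun x hx => hx.1),
    h.ncard_eq, h'.ncard_eq]

/-- The conditions `F j` may overlap, but no inclusion-exclusion is needed: if `F j θ` holds, all
elements with label `θ` already lie in the part given by this one `j`. -/
theorem matched_of_cover {J : Type*} [Nonempty β] (hX : X.Finite) (hY : Y.Finite)
    (F : J → T → Prop) (P : J → α → Prop) (Q : J → β → Prop)
    (hP : ∀ j, ∀ x ∈ X, F j (p x) → P j x) (hQ : ∀ j, ∀ y ∈ Y, F j (q y) → Q j y)
    (h : ∀ j, Matched {x ∈ X | P j x} {y ∈ Y | Q j y} p q) :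
    Matched {x ∈ X | ∃ j, F j (p x)} {y ∈ Y | ∃ j, F j (q y)} p q := by
  refine matched_of_ncard_eq (hX.subset fun x hx => hx.1) (hY.subset fun x hx => hx.1) fun θ => ?_
  by_cases hθ : ∃ j, F j θ
  · obtain ⟨j, hj⟩ := hθ
    convert (h j).ncard_eq θ using 2
    · ext x
      simp only [mem_ofPred_eq]
      constructor
      · rintro ⟨⟨hx, -⟩, rfl⟩; exact ⟨⟨hx, hP j x hx hj⟩, rfl⟩
      · rintro ⟨⟨hx, -⟩, rfl⟩; exact ⟨⟨hx, j, hj⟩, rfl⟩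
    · ext x
      simp only [mem_ofPred_eq]
      constructor
      · rintro ⟨⟨hx, -⟩, rfl⟩; exact ⟨⟨hx, hQ j x hx hj⟩, rfl⟩
      · rintro ⟨⟨hx, -⟩, rfl⟩; exact ⟨⟨hx, j, hj⟩, rfl⟩
  · have e1 : {x ∈ {x ∈ X | ∃ j, F j (p x)} | p x = θ} = ∅ :=
      eq_empty_of_forall_notMem fun x hx => hθ (hx.2 ▸ hx.1.2)
    have e2 : {x ∈ {x ∈ Y | ∃ j, F j (q x)} | q x = θ} = ∅ :=
      eq_empty_of_forall_notMem fun x hx => hθ (hx.2 ▸ hx.1.2)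
    rw [e1, e2, ncard_empty, ncard_empty]

end Matching

/-! ### Extensions of a tuple, fibred over one coordinate -/

section Extensions

variable {A B ι T : Type*}

/-- The tuples that agree with `a` outside of `V`. -/
def Ext (V : Finset ι) (a : ι → A) : Set (ι → A) := {c | ∀ i, i ∉ V → c i = a i}

theorem ext_finite [Finite A] (V : Finset ι) (a : ι → A) : (Ext V a).Finite := by
  refine Set.Finite.of_injOn (f := fun c (i : V) => c i) (mapsTo_univ _ _) ?_ finite_univ
  intro c hc d hd hcd
  funext i
  by_cases hi : i ∈ V
  · exact congrFun hcd ⟨i, hi⟩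
  · rw [hc i hi, hd i hi]

variable [DecidableEq ι]

theorem mem_ext_erase_update {V : Finset ι} {a c : ι → A} {j : ι} (hj : j ∈ V) {e : A} :
    c ∈ Ext (V.erase j) (Function.update a j e) ↔ c ∈ Ext V a ∧ c j = e := by
  constructor
  · intro h
    refine ⟨fun i hi => ?_, by simpa using h j (by simp)⟩
    have hij : i ≠ j := fun hij => hi (hij ▸ hj)
    rw [h i (by simp [hi]), Function.update_of_ne hij]
  · rintro ⟨h, rfl⟩ i hi
    by_cases hij : i = j
    · subst hij; simp
    · rw [Function.update_of_ne hij]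
      exact h i fun hiV => hi (Finset.mem_erase.2 ⟨hij, hiV⟩)

theorem matched_ext_of_fibres {V : Finset ι} {a : ι → A} {b : ι → B} {j : ι} (hj : j ∈ V)
    {N : Set A} {M : Set B} {g : A → B} (hg : BijOn g N M) {p : (ι → A) → T} {q : (ι → B) → T}
    (h : ∀ e ∈ N, Matched (Ext (V.erase j) (Function.update a j e))
      (Ext (V.erase j) (Function.update b j (g e))) p q) :
    Matched {c ∈ Ext V a | c j ∈ N} {d ∈ Ext V b | d j ∈ M} p q := by
  classical
  have h' : ∀ e, ∃ F : (ι → A) → ι → B, e ∈ N → BijOn F (Ext (V.erase j) (Function.update a j e))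
      (Ext (V.erase j) (Function.update b j (g e))) ∧
      ∀ c ∈ Ext (V.erase j) (Function.update a j e), q (F c) = p c := fun e => by
    by_cases he : e ∈ N
    · obtain ⟨F, hF⟩ := h e he
      exact ⟨F, fun _ => hF⟩
    · exact ⟨fun _ => b, fun he' => (he he').elim⟩
  choose F hF using h'
  have hmem : ∀ c ∈ {c ∈ Ext V a | c j ∈ N}, c ∈ Ext (V.erase j) (Function.update a j (c j)) :=
    fun c hc => (mem_ext_erase_update hj).2 ⟨hc.1, rfl⟩
  have him : ∀ c ∈ {c ∈ Ext V a | c j ∈ N}, F (c j) c ∈ Ext V b ∧ F (c j) c j = g (c j) :=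
    fun c hc => (mem_ext_erase_update hj).1 ((hF _ hc.2).1.mapsTo (hmem c hc))
  refine ⟨fun c => F (c j) c, ⟨fun c hc => ?_, fun c hc c' hc' hcc => ?_, ?_⟩,
    fun c hc => (hF _ hc.2).2 c (hmem c hc)⟩
  · refine ⟨(him c hc).1, ?_⟩
    have := hg.mapsTo hc.2
    rwa [← (him c hc).2] at this
  · have hcc' : F (c j) c = F (c' j) c' := hcc
    have hjj : c j = c' j := hg.injOn hc.2 hc'.2 (by
      rw [← (him c hc).2, ← (him c' hc').2, hcc'])
    have h2 := hmem c' hc'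
    rw [← hjj] at h2 hcc'
    exact (hF _ hc.2).1.injOn (hmem c hc) h2 hcc'
  · rintro d ⟨hd, hdM⟩
    obtain ⟨e, he, hed⟩ := hg.surjOn hdM
    obtain ⟨c, hc, rfl⟩ := (hF e he).1.surjOn ((mem_ext_erase_update hj).2 ⟨hd, hed.symm⟩)
    obtain ⟨hc1, rfl⟩ := (mem_ext_erase_update hj).1 hc
    exact ⟨c, ⟨hc1, he⟩, rfl⟩

end Extensions

/-! ### Comparison of single-element spheres -/

section GlobalEq

variable {L : FirstOrder.Language.{u, v}} {ι A B : Type} [L.Structure A] [L.Structure B] [Nonempty A]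

/-- Some bijection preserves the isomorphism types of the `R`-spheres of single elements. -/
def GlobalEq (L : FirstOrder.Language.{u, v}) (ι A B : Type) [L.Structure A] [L.Structure B]
    (R : ℕ) : Prop :=
  ∃ f : A → B, Function.Bijective f ∧
    ∀ (e : A) (j : ι), SIso L {j} R (fun _ : ι => e) (fun _ : ι => f e)

theorem GlobalEq.mono {R R' : ℕ} (h : R' ≤ R) (hAB : GlobalEq L ι A B R) :
    GlobalEq L ι A B R' := by
  obtain ⟨f, hf, hfR⟩ := hAB
  exact ⟨f, hf, fun e j => (hfR e j).mono Subset.rfl h⟩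

theorem GlobalEq.symm {R : ℕ} (hAB : GlobalEq L ι A B R) : GlobalEq L ι B A R := by
  obtain ⟨f, hf, hfR⟩ := hAB
  refine ⟨(Equiv.ofBijective f hf).symm, (Equiv.ofBijective f hf).symm.bijective, fun e j => ?_⟩
  have := (hfR ((Equiv.ofBijective f hf).symm e) j).symm
  rwa [Equiv.ofBijective_apply_symm_apply f hf] at this

end GlobalEq

/-! ### Sphere types and the counting argument -/

section Types

/-- A non-empty structure with a distinguished tuple. -/
structure Pointed (L : FirstOrder.Language.{u, v}) (ι : Type) where
  carrier : Type
  [nonempty : Nonempty carrier]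
  [str : L.Structure carrier]
  pt : ι → carrier

attribute [instance] Pointed.nonempty Pointed.str

variable (L : FirstOrder.Language.{u, v}) {ι : Type} {A B : Type} [L.Structure A] [L.Structure B]
  [Nonempty A] [Nonempty B]

/-- Isomorphism of spheres. -/
def sphereSetoid (S : Set ι) (r : ℕ) : Setoid (Pointed L ι) where
  r x y := SIso L S r x.pt y.pt
  iseqv := ⟨fun _ => ⟨id, IsIso.refl _ _ _⟩, fun h => h.symm,
    fun ⟨_, hf⟩ ⟨_, hg⟩ => ⟨_, hf.trans hg⟩⟩

/-- The isomorphism type of the `r`-sphere of a tuple. -/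
def sphereType (S : Set ι) (r : ℕ) (a : ι → A) : Quotient (sphereSetoid L S r (ι := ι)) :=
  Quotient.mk _ ⟨A, a⟩

variable {L}

theorem sphereType_eq_iff {S : Set ι} {r : ℕ} {a : ι → A} {b : ι → B} :
    sphereType L S r b = sphereType L S r a ↔ SIso L S r a b := by
  constructor
  · intro h
    exact Quotient.exact (s := sphereSetoid L S r) h.symm
  · intro h
    exact (Quotient.sound (s := sphereSetoid L S r) (a := ⟨A, a⟩) (b := ⟨B, b⟩) h).symm

/-- The isomorphism around `a` matches the possible values of coordinate `j`. Making that value a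
centre costs `2r+1` of the radius and leaves enough for `ih`. -/
theorem matched_ext_of_near [Finite A] [Finite B] [DecidableEq ι] {r m : ℕ} {V : Finset ι}
    {S : Set ι} {a : ι → A} {b : ι → B}
    (hab : SIso L S ((m + 1) * (2 * r + 1) + r) a b)
    (ih : ∀ j ∈ V, ∀ (a' : ι → A) (b' : ι → B),
      SIso L (insert j S) (m * (2 * r + 1) + r) a' b' →
        Matched (Ext (V.erase j) a') (Ext (V.erase j) b')
          (sphereType L (S ∪ V) r) (sphereType L (S ∪ V) r)) {j : ι} (hj : j ∈ V) :
    Matched {c ∈ Ext V a | c j ∈ Nb L S (2 * r + 1) a} {d ∈ Ext V b | d j ∈ Nb L S (2 * r + 1) b}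
      (sphereType L (S ∪ V) r) (sphereType L (S ∪ V) r) := by
  obtain ⟨f, hf⟩ := hab
  have hle : 2 * r + 1 + (m * (2 * r + 1) + r) = (m + 1) * (2 * r + 1) + r := by ring
  refine matched_ext_of_fibres hj (hf.bijOn_nb (by omega)) fun e he => ih j hj _ _ ⟨f, ?_⟩
  refine hf.restrict hle.le (fun i hi => ?_) fun i hi => ?_
  · by_cases hij : i = j
    · subst hij; simpa using he
    · rw [Function.update_of_ne hij]
      exact Nb.mem_self _ a (hi.resolve_left hij)
  · by_cases hij : i = j
    · subst hij; simp
    · rw [Function.update_of_ne hij, Function.update_of_ne hij]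
      exact hf.map_centre i (hi.resolve_left hij)

/-- Tuples that extend two tuples with isomorphic spheres realise each sphere type equally often. -/
theorem matched_ext [Finite A] [Finite B] [DecidableEq ι] {R r : ℕ} (hR : GlobalEq L ι A B R)
    (m : ℕ) :
    ∀ (V : Finset ι), V.card = m → ∀ (S : Set ι), Disjoint S V → m * (2 * r + 1) + r ≤ R →
      ∀ (a : ι → A) (b : ι → B), SIso L S (m * (2 * r + 1) + r) a b →
        Matched (Ext V a) (Ext V b) (sphereType L (S ∪ V) r) (sphereType L (S ∪ V) r) := by
  induction m with
  | zero =>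
    intro V hV S _ _ a b hab
    rw [Finset.card_eq_zero] at hV
    subst hV
    have hA : Ext ∅ a = {a} := by
      ext c; simp [Ext, funext_iff]
    have hB : Ext ∅ b = {b} := by
      ext c; simp [Ext, funext_iff]
    rw [hA, hB]
    refine ⟨fun _ => b, by simp, ?_⟩
    rintro c rfl
    rw [sphereType_eq_iff]
    simpa using hab
  | succ m ih =>
    intro V hV S hSV hmR a b hab
    have hmle : (m + 1) * (2 * r + 1) + r = m * (2 * r + 1) + r + (2 * r + 1) := by ring
    have hcard : ∀ j ∈ V, (V.erase j).card = m := fun j hj => by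
      rw [Finset.card_erase_of_mem hj, hV]; rfl
    have hXf := ext_finite V a
    have hYf := ext_finite V b
    -- For the types of the new part alone, `S` is forgotten: one `j ∈ V` takes its place as the
    -- only old entry, and `GlobalEq` matches its values.
    have hVlabel : Matched (Ext V a) (Ext V b) (sphereType L (V : Set ι) r)
        (sphereType L (V : Set ι) r) := by
      obtain ⟨j, hj⟩ : V.Nonempty := Finset.card_pos.1 (by omega)
      obtain ⟨f, hf, hfR⟩ := hR
      have hjV : {j} ∪ (V.erase j : Set ι) = V := by
        rw [Finset.coe_erase, singleton_union, insert_sdiff_singleton, insert_eq_of_mem (by simpa)]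
      have := matched_ext_of_fibres (a := a) (b := b) hj (bijOn_univ.2 hf)
        (p := sphereType L (V : Set ι) r) (q := sphereType L (V : Set ι) r) fun e _ => by
          have := ih (V.erase j) (hcard j hj) {j} (by simp) (by omega) (Function.update a j e)
            (Function.update b j (f e))
            (((hfR e j).mono Subset.rfl (by omega)).congr (fun i hi => by
              rw [mem_singleton_iff.1 hi]; simp) fun i hi => by
              rw [mem_singleton_iff.1 hi]; simp)
          rwa [hjV] at this
      simpa using this
    -- Being linked, as a property of labels, as `matched_of_cover` requires.
    let F : V → Quotient (sphereSetoid L (S ∪ V) r) → Prop := fun j θ =>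
      ∃ x : Pointed L ι, Quotient.mk _ x = θ ∧ Linked L S (S ∪ V) r x.pt j
    have hF : ∀ {A : Type} [L.Structure A] [Nonempty A] (c : ι → A) (j : V),
        F j (sphereType L (S ∪ V) r c) ↔ Linked L S (S ∪ V) r c j := by
      intro A _ _ c j
      constructor
      · rintro ⟨x, hx, hl⟩
        exact hl.map subset_union_left (Or.inr j.2)
          (Quotient.exact (s := sphereSetoid L (S ∪ V) r) hx)
      · intro hl
        exact ⟨⟨A, c⟩, rfl, hl⟩
    have hExt : ∀ {A : Type} {a c : ι → A}, c ∈ Ext V a → EqOn c a S := fun hc i hi =>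
      hc i fun hiV => Set.disjoint_left.1 hSV hi hiV
    -- The extensions with a linked new entry.
    have h1 := matched_of_cover (p := sphereType L (S ∪ V) r) (q := sphereType L (S ∪ V) r) hXf hYf F
      (fun j c => c j ∈ Nb L S (2 * r + 1) a) (fun j c => c j ∈ Nb L S (2 * r + 1) b)
      (fun j c hc h => Nb.congr (L := L) (hExt hc) ▸ ((hF c j).1 h).mem_nb)
      (fun j c hc h => Nb.congr (L := L) (hExt hc) ▸ ((hF c j).1 h).mem_nb)
      (fun j => matched_ext_of_near hab (fun i hi a' b' h => by
        have hiV : insert i S ∪ (V.erase i : Set ι) = S ∪ V := by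
          rw [insert_union, ← union_insert, Finset.coe_erase, insert_sdiff_singleton,
            insert_eq_of_mem (by simpa)]
        have := ih (V.erase i) (hcard i hi) (insert i S) (by
          rw [Set.disjoint_left]
          rintro k (rfl | hk) hkV
          · simp at hkV
          · exact Set.disjoint_left.1 hSV hk (Finset.mem_of_mem_erase hkV)) (by omega) a' b' h
        rwa [hiV] at this) j.2)
    -- The remaining extensions, so far only by the type over `V`.
    have h2 := hVlabel.diff hXf hYf (fun x hx => hx.1) (fun x hx => hx.1)
      (h1.map_label fun x _ y _ hxy => sphereType_eq_iff.2
        ((sphereType_eq_iff.1 hxy).mono subset_union_right le_rfl))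
    -- Without links, the type over `V` and the fixed sphere over `S` determine the type over `S ∪
    -- V`.
    have h3 := h2.map_label (p' := sphereType L (S ∪ V) r) (q' := sphereType L (S ∪ V) r)
      fun x hx y hy hxy => sphereType_eq_iff.2 <| by
        refine SIso.union ?_ (sphereType_eq_iff.1 hxy) (fun j hj hl => ?_) fun j hj hl => ?_
        · exact (hab.mono Subset.rfl (by omega)).congr (hExt hx.1) (hExt hy.1)
        · exact hx.2 ⟨hx.1, ⟨j, hj⟩, (hF x ⟨j, hj⟩).2 hl⟩
        · exact hy.2 ⟨hy.1, ⟨j, hj⟩, (hF y ⟨j, hj⟩).2 hl⟩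
    have h4 := Matched.union (hXf.subset (union_subset (fun x hx => hx.1) sdiff_subset))
      (hYf.subset (union_subset (fun x hx => hx.1) sdiff_subset))
      disjoint_sdiff_right disjoint_sdiff_right h1 h3
    rwa [union_sdiff_cancel fun x hx => hx.1, union_sdiff_cancel fun x hx => hx.1] at h4

/-- Every choice of elements for the indices in `V` has a counterpart with an isomorphic sphere. -/
theorem exists_ext_sIso [Finite A] [Finite B] [DecidableEq ι] {r l : ℕ}
    (hR : GlobalEq L ι A B (l * (2 * r + 1) + r)) {V : Finset ι} (hV : V.card ≤ l) {S : Set ι}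
    (hSV : Disjoint S V) {a : ι → A} {b : ι → B} (hab : SIso L S (l * (2 * r + 1) + r) a b)
    {c : ι → A} (hc : c ∈ Ext V a) : ∃ d ∈ Ext V b, SIso L (S ∪ V) r c d := by
  have hle : V.card * (2 * r + 1) + r ≤ l * (2 * r + 1) + r := by gcongr
  obtain ⟨f, hf, hl⟩ := matched_ext hR V.card V rfl S hSV hle a b (hab.mono Subset.rfl hle)
  exact ⟨f c, hf.mapsTo hc, sphereType_eq_iff.1 (hl c hc)⟩

end Types

/-! ### Transfer of formulas along isomorphic spheres -/

section Transfer

variable {L : FirstOrder.Language.{u, v}} {A B : Type} [L.Structure A] [L.Structure B]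

namespace FO

theorem realize_exs (xs : List ℕ) (ψ : FO L) (β : ℕ → A) :
    (exs xs ψ).Realize β ↔ ∃ β' ∈ Ext xs.toFinset β, ψ.Realize β' := by
  induction xs generalizing β with
  | nil =>
    constructor
    · exact fun h => ⟨β, fun _ _ => rfl, h⟩
    · rintro ⟨β', hβ', h⟩
      rwa [show β' = β from funext fun i => hβ' i (by simp)] at h
  | cons x xs ih =>
    change (∃ e, (exs xs ψ).Realize (Function.update β x e)) ↔ _
    simp only [ih]
    constructor
    · rintro ⟨e, β', hβ', h⟩
      refine ⟨β', fun i hi => ?_, h⟩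
      simp only [List.toFinset_cons, Finset.mem_insert, not_or] at hi
      rw [hβ' i hi.2, Function.update_of_ne hi.1]
    · rintro ⟨β', hβ', h⟩
      refine ⟨β' x, β', fun i hi => ?_, h⟩
      by_cases hix : i = x
      · subst hix; simp
      · rw [Function.update_of_ne hix]
        exact hβ' i (by simp [hix, List.mem_toFinset.not.1 hi])

theorem free_subset_free_exs_union (xs : List ℕ) (ψ : FO L) :
    ψ.free ⊆ (exs xs ψ).free ∪ (xs.toFinset : Set ℕ) := by
  induction xs with
  | nil => exact fun y hy => Or.inl hy
  | cons x xs ih =>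
    intro y hy
    by_cases hyx : y = x
    · exact Or.inr (by simp [hyx])
    · rcases ih hy with h | h
      · exact Or.inl ⟨h, hyx⟩
      · exact Or.inr (by
          simp only [List.coe_toFinset, mem_ofPred_eq, List.mem_cons] at h ⊢
          exact Or.inr h)

theorem IsQF.realize_iff {φ : FO L} (hφ : φ.IsQF) {S : Set ℕ} (hS : φ.free ⊆ S) {β : ℕ → A}
    {γ : ℕ → B} (h : SIso L S 0 β γ) : φ.Realize β ↔ φ.Realize γ := by
  induction φ with
  | eq x y =>
    obtain ⟨f, hf⟩ := h
    have hx : x ∈ S := hS (Or.inl rfl)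
    have hy : y ∈ S := hS (Or.inr rfl)
    change β x = β y ↔ γ x = γ y
    rw [← hf.map_centre x hx, ← hf.map_centre y hy]
    exact (hf.bijOn.injOn.eq_iff (Nb.mem_self 0 β hx) (Nb.mem_self 0 β hy)).symm
  | rel R xs =>
    obtain ⟨f, hf⟩ := h
    have hx : ∀ i, xs i ∈ S := fun i => hS ⟨i, rfl⟩
    change Structure.RelMap R (fun i => β (xs i)) ↔ Structure.RelMap R (fun i => γ (xs i))
    rw [← hf.map_rel R _ fun i => Nb.mem_self 0 β (hx i)]
    simp only [Function.comp_def, hf.map_centre _ (hx _)]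
  | not φ ih => exact not_congr (ih hφ hS)
  | or φ ψ ih1 ih2 =>
    exact or_congr (ih1 hφ.1 fun _ hx => hS (Or.inl hx)) (ih2 hφ.2 fun _ hx => hS (Or.inr hx))
  | ex => exact hφ.elim

end FO

/-- The radius that suffices for `n` blocks of `l` quantifiers. -/
def blockRadius (l : ℕ) : ℕ → ℕ
  | 0 => 0
  | n + 1 => l * (2 * blockRadius l n + 1) + blockRadius l n

theorem two_mul_blockRadius_add_one (l n : ℕ) : 2 * blockRadius l n + 1 = (2 * l + 1) ^ n := by
  induction n with
  | zero => rfl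
  | succ n ih => rw [pow_succ, ← ih, blockRadius]; ring

theorem blockRadius_lt (l n : ℕ) : blockRadius l n < (2 * l + 1) ^ n := by
  rw [← two_mul_blockRadius_add_one]; omega

theorem FO.BSigma.realize_iff [Finite A] [Finite B] [Nonempty A] [Nonempty B] {l : ℕ} (n : ℕ) :
    ∀ {φ : FO L}, BSigma n l φ → GlobalEq L ℕ A B (blockRadius l n) → ∀ {S : Set ℕ}, φ.free ⊆ S →
      ∀ {β : ℕ → A} {γ : ℕ → B}, SIso L S (blockRadius l n) β γ →
        (φ.Realize β ↔ φ.Realize γ) := by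
  induction n with
  | zero => exact fun hφ _ _ hS _ _ h => IsQF.realize_iff hφ hS h
  | succ n ih =>
    intro φ hφ hAB S hS β γ h
    induction hφ with
    | not _ ih' => exact not_congr (ih' hS)
    | or _ _ ih1 ih2 =>
      exact or_congr (ih1 fun _ hx => hS (Or.inl hx)) (ih2 fun _ hx => hS (Or.inr hx))
    | base hφ =>
      obtain ⟨xs, ψ, hxs, hψ, rfl⟩ := hφ
      have hcard : xs.toFinset.card ≤ l := xs.toFinset_card_le.trans hxs
      -- Quantified variables may also occur in `S`; their old values are overwritten, so they are
      -- dropped as centres.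
      have hdisj : Disjoint (S \ (xs.toFinset : Set ℕ)) xs.toFinset := disjoint_sdiff_left
      have h' := h.mono (sdiff_subset (t := (xs.toFinset : Set ℕ))) le_rfl
      have hle : blockRadius l n ≤ blockRadius l (n + 1) := Nat.le_add_left _ _
      have hfree : ψ.free ⊆ S \ (xs.toFinset : Set ℕ) ∪ xs.toFinset := by
        rw [sdiff_union_self]
        exact (free_subset_free_exs_union xs ψ).trans (union_subset_union_left _ hS)
      rw [realize_exs, realize_exs]
      constructor
      · rintro ⟨β', hβ', hr⟩
        obtain ⟨γ', hγ', hs⟩ := exists_ext_sIso hAB hcard hdisj h' hβ'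
        exact ⟨γ', hγ', (ih hψ (hAB.mono hle) hfree hs).1 hr⟩
      · rintro ⟨γ', hγ', hr⟩
        obtain ⟨β', hβ', hs⟩ := exists_ext_sIso hAB.symm hcard hdisj h'.symm hγ'
        exact ⟨β', hβ', (ih hψ (hAB.mono hle) hfree hs.symm).2 hr⟩

end Transfer

/-! ### From Hanf equivalence to the bound on the rank -/

section Spheres

variable {L : FirstOrder.Language.{u, v}} [L.IsRelational] {A B : Type} [L.Structure A]
  [L.Structure B]

theorem SphereIso.sIso [Nonempty B] {r k : ℕ} {a : Fin k → A} {b : Fin k → B}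
    (h : SphereIso L r a b) : SIso L univ r a b := by
  classical
  obtain ⟨e, he⟩ := h
  -- The value outside the sphere is irrelevant.
  let f : A → B := fun x => if hx : x ∈ sphere L r a then e ⟨x, hx⟩ else Classical.arbitrary B
  have hf : ∀ x : sphere L r a, f x = e x := fun x => by simp [f]
  refine ⟨f, ?_, fun i _ => ?_, fun {n} R t ht => ?_⟩
  · rw [nb_univ_eq_nbhd, nb_univ_eq_nbhd]
    refine ⟨fun x hx => ?_, fun x hx y hy hxy => ?_, fun y hy => ?_⟩
    · rw [hf ⟨x, hx⟩]
      exact (e ⟨x, hx⟩).2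
    · rw [hf ⟨x, hx⟩, hf ⟨y, hy⟩] at hxy
      exact congrArg Subtype.val (e.injective (Subtype.ext hxy))
    · refine ⟨e.symm ⟨y, hy⟩, (e.symm ⟨y, hy⟩).2, ?_⟩
      rw [hf, e.apply_symm_apply]
  · have := hf (centre L r a i)
    rw [he i] at this
    exact this
  · rw [nb_univ_eq_nbhd] at ht
    have := e.map_rel R (fun i => (⟨t i, ht i⟩ : sphere L r a))
    have h1 : f ∘ t = fun i => ((e ⟨t i, ht i⟩ : sphere L r b) : B) :=
      funext fun i => hf ⟨t i, ht i⟩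
    rw [h1]
    exact this

theorem HanfEquiv.globalEq [Nonempty A] [Nonempty B] {r k : ℕ} {a : Fin k → A} {b : Fin k → B}
    (h : HanfEquiv L r a b) : GlobalEq L ℕ A B r := by
  obtain ⟨f, hf⟩ := h
  refine ⟨f, f.bijective, fun e j => ?_⟩
  obtain ⟨g, hg⟩ := (hf e).sIso
  have h0 := hg.map_centre (Fin.last k) (mem_univ _)
  have h1 := Nb.mem_self (L := L) 0 (Fin.snoc a e : Fin (k + 1) → A) (mem_univ (Fin.last k))
  rw [Fin.snoc_last] at h0 h1
  rw [Fin.snoc_last] at h0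
  exact ⟨g, hg.restrict (s := 0) (by omega) (fun _ _ => h1) fun _ _ => h0⟩

theorem HanfEquiv.sIso [Nonempty A] [Nonempty B] {r k : ℕ} {a : Fin k → A} {b : Fin k → B}
    (h : HanfEquiv L r a b) {x : Fin k → ℕ} {β : ℕ → A} {γ : ℕ → B} (hβ : ∀ i, β (x i) = a i)
    (hγ : ∀ i, γ (x i) = b i) : SIso L (range x) r β γ := by
  obtain ⟨f, hf⟩ := h
  obtain ⟨g, hg⟩ := (hf (Classical.arbitrary A)).sIso
  refine ⟨g, hg.restrict (s := 0) (by omega) ?_ ?_⟩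
  · rintro _ ⟨i, rfl⟩
    have := Nb.mem_self (L := L) 0 (Fin.snoc a (Classical.arbitrary A) : Fin (k + 1) → A)
      (mem_univ i.castSucc)
    rwa [Fin.snoc_castSucc, ← hβ] at this
  · rintro _ ⟨i, rfl⟩
    have := hg.map_centre i.castSucc (mem_univ _)
    rwa [Fin.snoc_castSucc, Fin.snoc_castSucc, ← hβ, ← hγ] at this

theorem exists_assignment [Nonempty A] {k : ℕ} {x : Fin k → ℕ} (hx : Function.Injective x)
    (a : Fin k → A) : ∃ β : ℕ → A, ∀ i, β (x i) = a i :=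
  ⟨Function.extend x a fun _ => Classical.arbitrary A, fun i => hx.extend_apply _ _ i⟩

theorem hanfLocalAt_blockRadius {n l : ℕ} {φ : FO L} (hφ : FO.BSigma n l φ) {k : ℕ}
    {x : Fin k → ℕ} (hx : Function.Injective x) (hfree : φ.free ⊆ range x) :
    HanfLocalAt φ x (blockRadius l n) := by
  intro A B _ _ _ _ _ _ a b hab
  have key : ∀ {β : ℕ → A} {γ : ℕ → B}, (∀ i, β (x i) = a i) → (∀ i, γ (x i) = b i) →
      (φ.Realize β ↔ φ.Realize γ) := fun hβ hγ =>
    hφ.realize_iff n hab.globalEq hfree (hab.sIso hβ hγ)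
  constructor
  · rintro ⟨β, hβ, h⟩
    obtain ⟨γ, hγ⟩ := exists_assignment hx b
    exact ⟨γ, hγ, (key hβ hγ).1 h⟩
  · rintro ⟨γ, hγ, h⟩
    obtain ⟨β, hβ⟩ := exists_assignment hx a
    exact ⟨β, hβ, (key hβ hγ).2 h⟩

theorem hanfLocalityRank_lt {n l : ℕ} {φ : FO L} (hφ : FO.BSigma n l φ) {k : ℕ}
    {x : Fin k → ℕ} (hx : Function.Injective x) (hfree : φ.free ⊆ range x) :
    hanfLocalityRank φ x < (2 * l + 1) ^ n :=
  (Nat.sInf_le (hanfLocalAt_blockRadius hφ hx hfree)).trans_lt (blockRadius_lt l n)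

end Spheres

/-! ### Quantifiers and size -/

namespace FO

variable {L : FirstOrder.Language.{u, v}}

/-- The number of quantifiers of a formula. -/
def numQuantifiers : FO L → ℕ
  | eq _ _ => 0
  | rel _ _ => 0
  | not φ => φ.numQuantifiers
  | or φ ψ => φ.numQuantifiers + ψ.numQuantifiers
  | ex _ φ => φ.numQuantifiers + 1

theorem two_mul_numQuantifiers_add_three_le_size [IsEmpty (L.Relations 0)] (φ : FO L) :
    2 * φ.numQuantifiers + 3 ≤ φ.size := by
  induction φ with
  | eq => simp [numQuantifiers, size]
  | @rel n R xs =>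
    cases n with
    -- An atom of arity 0 would have size 2, below the required 3.
    | zero => exact isEmptyElim R
    | succ n => simp only [numQuantifiers, size]; omega
  | not φ ih => simp only [numQuantifiers, size]; omega
  | or φ ψ ih1 ih2 => simp only [numQuantifiers, size]; omega
  | ex y φ ih => simp only [numQuantifiers, size]; omega

theorem numQuantifiers_exs (xs : List ℕ) (ψ : FO L) :
    (exs xs ψ).numQuantifiers = xs.length + ψ.numQuantifiers := by
  induction xs with
  | nil => simp [exs]
  | cons x xs ih =>
    change (exs xs ψ).numQuantifiers + 1 = _
    rw [ih, List.length_cons]; omega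

/-- No block in `φ` is longer than the total number of quantifiers of `φ`. -/
theorem BSigma.of_numQuantifiers_le {l l' n : ℕ} {φ : FO L} (hφ : BSigma n l φ)
    (hl : φ.numQuantifiers ≤ l') : BSigma n l' φ := by
  induction n generalizing φ with
  | zero => exact hφ
  | succ n ih =>
    change BoolComb _ φ
    induction hφ with
    | base h =>
      obtain ⟨xs, ψ, -, hψ, rfl⟩ := h
      rw [numQuantifiers_exs] at hl
      exact .base ⟨xs, ψ, by omega, ih hψ (by omega), rfl⟩
    | not _ ih' => exact .not (ih' hl)
    | @or φ ψ _ _ ih1 ih2 =>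
      have hl' : φ.numQuantifiers + ψ.numQuantifiers ≤ l' := hl
      exact .or (ih1 (by omega)) (ih2 (by omega))

end FO

end HanfLocality

theorem mainTheorem6 {L : FirstOrder.Language} [L.IsRelational]
    [Finite (Σ m, L.Relations m)] [IsEmpty (L.Relations 0)]
    (n l : ℕ) (hl : 1 ≤ l) (φ : HanfLocality.FO L) (hφ : HanfLocality.FO.BSigma n l φ)
    {k : ℕ} (hk : 0 < k) (x : Fin k → ℕ) (hx : Function.Injective x)
    (hfree : φ.free ⊆ Set.range x) :
    HanfLocality.IsHanfLocal φ x ∧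
      HanfLocality.hanfLocalityRank φ x < (2 * l + 1) ^ n ∧
      HanfLocality.hanfLocalityRank φ x < φ.size ^ n ∧
      ((∀ l', 1 ≤ l' → HanfLocality.FO.BSigma n l' φ → l ≤ l') →
        (2 * l + 1) ^ n ≤ φ.size ^ n) := by
  have hsize := φ.two_mul_numQuantifiers_add_three_le_size
  have hφ' : HanfLocality.FO.BSigma n (max 1 φ.numQuantifiers) φ :=
    hφ.of_numQuantifiers_le (le_max_right _ _)
  -- With `q` quantifiers, `2 * max 1 q + 1 ≤ 2 * q + 3 ≤ φ.size`; a least `l` is at most `max 1 q`.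
  refine ⟨⟨_, HanfLocality.hanfLocalAt_blockRadius hφ hx hfree⟩,
    HanfLocality.hanfLocalityRank_lt hφ hx hfree,
    (HanfLocality.hanfLocalityRank_lt hφ' hx hfree).trans_le (Nat.pow_le_pow_left (by omega) n),
    fun h => Nat.pow_le_pow_left ?_ n⟩
  have := h _ (le_max_left _ _) hφ'
  omega
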